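/- Let $G$ be a compact real Lie group of dimension $d$ with Haar probability measure $\mu_G$ (the unique left-invariant Borel probability measure), let $(\xi_i)_{1\le i\le d}$ be a basis of the Lie algebra $\mathfrak g=T_eG$, and let $\theta^1,\dots,\theta^d$ be the components in this basis of the left Maurer–Cartan form $\theta(X_g)=T_gL_{g^{-1}}\cdot X_g$, $X_g\in T_gG$. For a $d$-form $\Omega$ on $G$ let $|\Omega|$ be the Borel measure on $G$ obtained by integrating $|\Omega|$ in local coordinates. Put $$C:=\int_G |\theta^1\wedge\dots\wedge\theta^d| .$$ Then $0<C<\infty$, and: 1. $\Omega_G:=C^{-1}\,\theta^1\wedge\dots\wedge\theta^d$ is a nowhere vanishing $d$-form on $G$ with $L_g^*\Omega_G=\Omega_G$ for all $g\in G$ and total mass $|\Omega_G|(G)=1$; it is, up to its sign (i.e. up to the choice of orientation), the only such form; and $|\Omega_G|=\mu_G$. 2. Let $p:U\to G$ be a local parametrisation (local coordinate system) of $G$, i.e. a smooth diffeomorphism of an open set $U\subset\mathbb R^d$ onto an open subset of $G$. Then for all $u\in U$ $$(p^*\Omega_G)_u=k(u)\,\mathrm du^1\wedge\dots\wedge \mathrm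 du^d,\qquad k(u)=C^{-1}\det\Big(\theta^i_{p(u)}\Big(\frac{\partial p}{\partial u^j}\Big)\Big)_{i,j},$$ and as a measure $p^*\mu_G=|k(u)|\,\mathrm du$, that is, $\mu_G(p(A))=\int_A |k(u)|\,\mathrm du$ for every Borel set $A\subset U$. 3. Suppose that $G$ is a matrix group, i.e. it is given with an injective homomorphism $G\to \mathrm{GL}_D(\mathbb R)$ that is smooth as a map to $\mathrm M_D(\mathbb R)$, by which $G$ and $\mathfrak g$ are identified with subsets of $\mathrm M_D(\mathbb R)$. Then $\theta(X_g)=g^{-1}X_g$. If moreover $(\xi_i)$ is orthonormal for $\langle A,B\rangle=\frac12\operatorname{Tr}(AB^{T})$, then for every $p$ as in 2 and every $u\in U$ $$k(u)=C^{-1}\det\Big(\Big\langle p(u)^{-1}\frac{\partial p}{\partial u^j},\ \xi_i\Big\rangle\Big)_{i,j}.$$ -/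

import Mathlib

open scoped Manifold ContDiff

noncomputable section

/-- The wedge product `α 0 ∧ ⋯ ∧ α (d - 1)` of linear forms, in the convention
`(α 0 ∧ ⋯ ∧ α (d - 1)) (v 0, …, v (d - 1)) = ∑ σ, sign σ * ∏ i, α i (v (σ i))`. -/
def wedgeOneForms {V : Type*} [AddCommGroup V] [Module ℝ V] {d : ℕ}
    (α : Fin d → (V →ₗ[ℝ] ℝ)) : V [⋀^Fin d]→ₗ[ℝ] ℝ :=
  MultilinearMap.alternatization
    ((MultilinearMap.mkPiAlgebra ℝ (Fin d) ℝ).compLinearMap α)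

/-- The `d`-form `du¹ ∧ ⋯ ∧ du^d` on `ℝ^d`. -/
def coordinateVolumeForm (d : ℕ) : (EuclideanSpace ℝ (Fin d)) [⋀^Fin d]→ₗ[ℝ] ℝ :=
  wedgeOneForms fun i => (EuclideanSpace.proj i : EuclideanSpace ℝ (Fin d) →L[ℝ] ℝ).toLinearMap

section Manifold

variable {E : Type*} [NormedAddCommGroup E] [NormedSpace ℝ E]
  {H : Type*} [TopologicalSpace H] (I : ModelWithCorners ℝ E H)
  (G : Type*) [TopologicalSpace G] [ChartedSpace H G]

/-- A local parametrisation (local coordinate system) `p : U → G`, with `U = p.source` open in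
`ℝ^d`: a smooth diffeomorphism of `U` onto an open subset of `G`. (The values of `p` outside of
`U` are irrelevant.) -/
abbrev LocalParametrisation (d : ℕ) :=
  PartialDiffeomorph 𝓘(ℝ, EuclideanSpace ℝ (Fin d)) I (EuclideanSpace ℝ (Fin d)) G ∞

/-- A field of alternating `d`-linear forms on the tangent spaces of `G`. -/
abbrev FormField (d : ℕ) := ∀ g : G, (TangentSpace I g) [⋀^Fin d]→ₗ[ℝ] ℝ

variable {I G}

/-- The tangent vector `∂p/∂u^j` at `p u`. -/
def LocalParametrisation.partialDeriv {d : ℕ} (p : LocalParametrisation I G d)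
    (u : EuclideanSpace ℝ (Fin d)) (j : Fin d) : TangentSpace I (p u) :=
  mfderiv 𝓘(ℝ, EuclideanSpace ℝ (Fin d)) I p u
    (EuclideanSpace.single j (1 : ℝ) : EuclideanSpace ℝ (Fin d))

/-- The pullback `(p^* Ω)_u` of a `d`-form on `G`. -/
def FormField.pullback {d : ℕ} (Ω : FormField I G d) (p : LocalParametrisation I G d)
    (u : EuclideanSpace ℝ (Fin d)) : (EuclideanSpace ℝ (Fin d)) [⋀^Fin d]→ₗ[ℝ] ℝ :=
  (Ω (p u)).compLinearMap
    (mfderiv 𝓘(ℝ, EuclideanSpace ℝ (Fin d)) I p u :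
      EuclideanSpace ℝ (Fin d) →L[ℝ] TangentSpace I (p u)).toLinearMap

/-- The Borel measure `|Ω|` on `G` defined by integrating the `d`-form `Ω` in local coordinates:
the least measure that dominates, for each local parametrisation `p : U → G`, the image under `p`
of the measure `|Ω (∂p/∂u¹, …, ∂p/∂u^d)| du` on `U`. (For a continuous `Ω` on a second countable
`G` these local measures agree on overlaps, so that `|Ω|` is obtained by gluing them.) -/
def FormField.measure [MeasurableSpace G] {d : ℕ} (Ω : FormField I G d) :
    MeasureTheory.Measure G :=
  ⨆ p : LocalParametrisation I G d,
    ((MeasureTheory.volume.restrict p.source).withDensity fun u =>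
      ENNReal.ofReal |Ω (p u) (LocalParametrisation.partialDeriv p u)|).map p

variable [Group G]

/-- A Haar volume form on `G`: a nowhere vanishing form of degree `d` which is invariant under all
left translations, `L_g^* Ω = Ω`, and has total mass one. (Left-invariant forms on a Lie group are
automatically smooth.) The total mass is taken for the Borel measure defined by `Ω`, i.e. `G` is
oriented by `Ω` itself. -/
structure IsHaarVolumeForm [MeasurableSpace G] {d : ℕ} (Ω : FormField I G d) : Prop where
  ne_zero : ∀ g, Ω g ≠ 0
  leftInvariant : ∀ g h : G,
    (Ω (g * h)).compLinearMap
      (mfderiv I I (fun x : G => g * x) h :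
        TangentSpace I h →L[ℝ] TangentSpace I (g * h)).toLinearMap = Ω h
  mass_one : FormField.measure Ω Set.univ = 1

/-- The left Maurer-Cartan form `θ(X_g) = T_g L_{g⁻¹} · X_g`. The derivative takes its values in
the tangent space at `g⁻¹ * g = 1`. -/
def leftMaurerCartan (g : G) : TangentSpace I g →ₗ[ℝ] GroupLieAlgebra I G :=
  (mfderiv I I (fun x : G => g⁻¹ * x) g :
    TangentSpace I g →L[ℝ] TangentSpace I (g⁻¹ * g)).toLinearMap

/-- The components `θ^i` of the left Maurer-Cartan form in a basis `ξ` of the Lie algebra. -/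
def maurerCartanComponent {d : ℕ} (ξ : Module.Basis (Fin d) ℝ (GroupLieAlgebra I G))
    (i : Fin d) (g : G) : TangentSpace I g →ₗ[ℝ] ℝ :=
  (ξ.coord i).comp (leftMaurerCartan g)

/-- The `d`-form `θ¹ ∧ ⋯ ∧ θ^d` on `G`. -/
def maurerCartanVolume {d : ℕ} (ξ : Module.Basis (Fin d) ℝ (GroupLieAlgebra I G)) :
    FormField I G d :=
  fun g => wedgeOneForms fun i => maurerCartanComponent ξ i g

end Manifold

section MatrixGroup

variable {E : Type*} [NormedAddCommGroup E] [NormedSpace ℝ E]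
  {H : Type*} [TopologicalSpace H] {I : ModelWithCorners ℝ E H}
  {G : Type*} [TopologicalSpace G] [ChartedSpace H G]

/-- The scalar product `⟨A, B⟩ = (1/2) Tr(A Bᵀ)` on square matrices. -/
def frobeniusInner {D : ℕ} (A B : Matrix (Fin D) (Fin D) ℝ) : ℝ :=
  (1 / 2 : ℝ) * (A * B.transpose).trace

/-- The derivative of a matrix valued map on `G`, entry by entry. -/
def matrixDeriv {D : ℕ} (F : G → Matrix (Fin D) (Fin D) ℝ) (g : G) (X : TangentSpace I g) :
    Matrix (Fin D) (Fin D) ℝ :=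
  Matrix.of fun a b => (mfderiv I 𝓘(ℝ, ℝ) (fun h : G => F h a b) g X : ℝ)

/-- The partial derivative `∂F/∂u^j` of a matrix valued map on `ℝ^d`, entry by entry. -/
def matrixPartialDeriv {D d : ℕ} (F : EuclideanSpace ℝ (Fin d) → Matrix (Fin D) (Fin D) ℝ)
    (u : EuclideanSpace ℝ (Fin d)) (j : Fin d) : Matrix (Fin D) (Fin D) ℝ :=
  Matrix.of fun a b => fderiv ℝ (fun w => F w a b) u (EuclideanSpace.single j (1 : ℝ))

end MatrixGroup

end

/-!
For a form `Ω` of top degree on `G` and a parametrisation `p`, let the density of `Ω` in `p` be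
`|Ω (∂p/∂u¹, …, ∂p/∂u^d)|` and let the local measure be the image under `p` of this density times
Lebesgue measure. Under a change of coordinates the density is multiplied by the absolute value of
the Jacobian determinant, so by the change of variables formula the local measures agree on
overlaps, and the measure `|Ω|`, their supremum, coincides on the image of `p` with the local
measure of `p` (`FormField.measure_eq_localMeasure`).

If `Ω` is left invariant, then so is `|Ω|`, because a translate of a parametrisation is a
parametrisation with the same density. Moreover the density is continuous: the value at `u` is the
value at `u₀` times the Jacobian, in the coordinates given by `p`, of the translation that moves
`p u` to `p u₀` (`FormField.IsLeftInvariant.continuousAt_density`). Hence, for nowhere vanishing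
`Ω`, some nonempty open set has positive finite measure, and by compactness so does `G`. Applied to
`θ¹ ∧ ⋯ ∧ θ^d`, which is left invariant and takes the value `1` on `ξ` at the identity, this gives
`0 < C < ∞`; uniqueness of the Haar probability measure identifies `|C⁻¹ θ¹ ∧ ⋯ ∧ θ^d|`.

A left invariant form is determined by its value at the identity, and forms of top degree on `𝔤` are
unique up to a factor; the total mass fixes this factor up to its sign. The local expressions are
the evaluation of a wedge product as a determinant, and for a matrix group `θ = g⁻¹ dg` is the chain
rule for `ρ (g⁻¹ x) = (ρ g)⁻¹ ρ x`.
-/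

noncomputable section

/-! ### Wedge products of linear forms -/

theorem wedgeOneForms_apply {V : Type*} [AddCommGroup V] [Module ℝ V] {d : ℕ}
    (α : Fin d → (V →ₗ[ℝ] ℝ)) (v : Fin d → V) :
    wedgeOneForms α v = Matrix.det (Matrix.of fun i j => α i (v j)) := by
  rw [← Matrix.det_transpose, Matrix.det_apply]
  simp [wedgeOneForms, MultilinearMap.alternatization_apply]

theorem coordinateVolumeForm_single (d : ℕ) :
    coordinateVolumeForm d (fun j => EuclideanSpace.single j (1 : ℝ)) = 1 := by
  rw [coordinateVolumeForm, wedgeOneForms_apply]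
  convert Matrix.det_one (n := Fin d) (R := ℝ)
  ext i j
  simp [Matrix.one_apply]

/-- A top degree form on `ℝ^d` is determined by its value on the standard basis. -/
theorem eq_smul_coordinateVolumeForm {d : ℕ}
    (f : (EuclideanSpace ℝ (Fin d)) [⋀^Fin d]→ₗ[ℝ] ℝ) :
    f = f (fun j => EuclideanSpace.single j (1 : ℝ)) • coordinateVolumeForm d := by
  let b := (EuclideanSpace.basisFun (Fin d) ℝ).toBasis
  have hb : (fun j => EuclideanSpace.single j (1 : ℝ)) = (b : Fin d → _) := by
    ext j; simp [b]
  have h1 := coordinateVolumeForm_single d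
  have h2 := (coordinateVolumeForm d).eq_smul_basis_det b
  rw [hb] at h1 ⊢
  rw [h1, one_smul] at h2
  rw [h2]
  exact f.eq_smul_basis_det b

/-- Precomposition of a top degree form on `ℝ^d` with an endomorphism multiplies it by the
determinant. -/
theorem alternatingMap_comp_single {d : ℕ}
    (f : (EuclideanSpace ℝ (Fin d)) [⋀^Fin d]→ₗ[ℝ] ℝ)
    (L : EuclideanSpace ℝ (Fin d) →ₗ[ℝ] EuclideanSpace ℝ (Fin d)) :
    f (fun j => L (EuclideanSpace.single j (1 : ℝ))) =
      LinearMap.det L * f (fun j => EuclideanSpace.single j (1 : ℝ)) := by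
  let b := (EuclideanSpace.basisFun (Fin d) ℝ).toBasis
  have hb : (fun j => EuclideanSpace.single j (1 : ℝ)) = (b : Fin d → _) := by
    ext j; simp [b]
  have hb' : (fun j => L (EuclideanSpace.single j (1 : ℝ))) = L ∘ b := by
    rw [← hb]; rfl
  rw [hb', hb, f.eq_smul_basis_det b]
  simp [b.det_comp, b.det_self, mul_comm]

/-! ### Local densities of a form -/

section Manifold

variable {E : Type*} [NormedAddCommGroup E] [NormedSpace ℝ E]
  {H : Type*} [TopologicalSpace H] {I : ModelWithCorners ℝ E H}
  {G : Type*} [TopologicalSpace G] [ChartedSpace H G] {d : ℕ}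

/-- Evaluation of a form on vectors of the model space `E`, of which every tangent space is a
copy. This removes the base point from the types of the vectors. -/
def FormField.eval (Ω : FormField I G d) (g : G) (v : Fin d → E) : ℝ := Ω g v

/-- The coefficient, up to sign, of the form `Ω` in the coordinates given by `p`. -/
def FormField.density (Ω : FormField I G d) (p : LocalParametrisation I G d)
    (u : EuclideanSpace ℝ (Fin d)) : ℝ :=
  |Ω (p u) (LocalParametrisation.partialDeriv p u)|

theorem LocalParametrisation.mdifferentiableAt (p : LocalParametrisation I G d)
    {u : EuclideanSpace ℝ (Fin d)} (hu : u ∈ p.source) :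
    MDifferentiableAt 𝓘(ℝ, EuclideanSpace ℝ (Fin d)) I p u :=
  PartialDiffeomorph.mdifferentiableAt p (by simp) hu

theorem LocalParametrisation.isOpen_inter_preimage (p : LocalParametrisation I G d) {s : Set G}
    (hs : IsOpen s) : IsOpen (p.source ∩ p ⁻¹' s) :=
  p.contMDiffOn.continuousOn.isOpen_inter_preimage p.open_source hs

theorem LocalParametrisation.isOpen_image (p : LocalParametrisation I G d)
    {s : Set (EuclideanSpace ℝ (Fin d))} (hs : IsOpen s) (h : s ⊆ p.source) : IsOpen (p '' s) :=
  p.toOpenPartialHomeomorph.isOpen_image_of_subset_source hs h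

/-- The transition map from the coordinates `q` to the coordinates `p`. -/
def LocalParametrisation.transition (q p : LocalParametrisation I G d) :
    EuclideanSpace ℝ (Fin d) → EuclideanSpace ℝ (Fin d) :=
  fun u => p.symm (q u)

theorem LocalParametrisation.contDiffAt_transition (q p : LocalParametrisation I G d)
    {u : EuclideanSpace ℝ (Fin d)} (hu : u ∈ q.source) (hqu : q u ∈ p.target) :
    ContDiffAt ℝ ∞ (q.transition p) u := by
  have h1 : ContMDiffAt 𝓘(ℝ, EuclideanSpace ℝ (Fin d)) I ∞ q u :=
    (q.contMDiffOn u hu).contMDiffAt (q.open_source.mem_nhds hu)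
  have h2 : ContMDiffAt I 𝓘(ℝ, EuclideanSpace ℝ (Fin d)) ∞ p.symm (q u) :=
    (p.symm.contMDiffOn _ hqu).contMDiffAt (p.open_target.mem_nhds hqu)
  exact (h2.comp u h1).contDiffAt

theorem LocalParametrisation.mfderiv_eq_comp_transition (q p : LocalParametrisation I G d)
    {u : EuclideanSpace ℝ (Fin d)} (hu : u ∈ q.source) (hqu : q u ∈ p.target) :
    (mfderiv 𝓘(ℝ, EuclideanSpace ℝ (Fin d)) I q u : EuclideanSpace ℝ (Fin d) →L[ℝ] E) =
      (mfderiv 𝓘(ℝ, EuclideanSpace ℝ (Fin d)) I p (q.transition p u) :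
        EuclideanSpace ℝ (Fin d) →L[ℝ] E).comp (fderiv ℝ (q.transition p) u) := by
  have hT : MDifferentiableAt 𝓘(ℝ, EuclideanSpace ℝ (Fin d)) 𝓘(ℝ, EuclideanSpace ℝ (Fin d))
      (q.transition p) u :=
    ((q.contDiffAt_transition p hu hqu).differentiableAt (by simp)).mdifferentiableAt
  have hs : q.transition p u ∈ p.source := p.map_target hqu
  have heq : (q : EuclideanSpace ℝ (Fin d) → G) =ᶠ[nhds u]
      (p : EuclideanSpace ℝ (Fin d) → G) ∘ q.transition p := by
    filter_upwards [(q.isOpen_inter_preimage p.open_target).mem_nhds ⟨hu, hqu⟩] with x hx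
    exact (p.right_inv hx.2).symm
  have h := heq.mfderiv_eq (I := 𝓘(ℝ, EuclideanSpace ℝ (Fin d))) (I' := I)
  have h' := h.trans (mfderiv_comp u (p.mdifferentiableAt hs) hT)
  rw [mfderiv_eq_fderiv] at h'
  exact h'

/-- The transformation rule of densities under a change of coordinates. -/
theorem FormField.density_eq_abs_det_mul (Ω : FormField I G d) (q p : LocalParametrisation I G d)
    {u : EuclideanSpace ℝ (Fin d)} (hu : u ∈ q.source) (hqu : q u ∈ p.target) :
    Ω.density q u =
      |(fderiv ℝ (q.transition p) u).det| * Ω.density p (q.transition p u) := by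
  have hpt : p (q.transition p u) = q u := p.right_inv hqu
  -- `p (p.symm (q u)) = q u` holds only propositionally, so the base point has to be transported.
  have h0 : ∀ g : G, g = q u → Ω.eval (q u) (fun j => LocalParametrisation.partialDeriv q u j) =
      Ω.eval g (fun j => LocalParametrisation.partialDeriv q u j) := by
    rintro g rfl; rfl
  have h1 : (fun j => LocalParametrisation.partialDeriv q u j : Fin d → E) = fun j =>
      (mfderiv 𝓘(ℝ, EuclideanSpace ℝ (Fin d)) I p (q.transition p u) :
        EuclideanSpace ℝ (Fin d) →L[ℝ] E) (fderiv ℝ (q.transition p) u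
          (EuclideanSpace.single j (1 : ℝ))) := by
    funext j
    exact DFunLike.congr_fun (q.mfderiv_eq_comp_transition p hu hqu) _
  have h2 := alternatingMap_comp_single (Ω.pullback p (q.transition p u))
    (fderiv ℝ (q.transition p) u).toLinearMap
  have h3 : Ω (q u) (LocalParametrisation.partialDeriv q u) =
      (fderiv ℝ (q.transition p) u).det *
        Ω (p (q.transition p u)) (LocalParametrisation.partialDeriv p (q.transition p u)) := by
    refine ((h0 _ hpt).trans ?_).trans h2
    rw [h1]
    rfl
  rw [FormField.density, FormField.density, h3, abs_mul]

/-! ### Gluing the local measures -/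

variable [MeasurableSpace G]

/-- The measure on `G` carried by the image of `p` and given there by the density of `Ω`. -/
def FormField.localMeasure (Ω : FormField I G d) (p : LocalParametrisation I G d) :
    MeasureTheory.Measure G :=
  ((MeasureTheory.volume.restrict p.source).withDensity fun u =>
    ENNReal.ofReal (Ω.density p u)).map p

theorem FormField.localMeasure_le (Ω : FormField I G d) (p : LocalParametrisation I G d) :
    Ω.localMeasure p ≤ Ω.measure :=
  le_iSup Ω.localMeasure p

variable [BorelSpace G]

theorem LocalParametrisation.measurableSet_preimage (p : LocalParametrisation I G d) {B : Set G}
    (hB : MeasurableSet B) : MeasurableSet (p ⁻¹' B ∩ p.source) := by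
  have h : Measurable (p.source.domRestrict p) :=
    (continuousOn_iff_continuous_domRestrict.1 p.contMDiffOn.continuousOn).measurable
  convert p.open_source.measurableSet.subtype_image (h hB)
  ext u
  simp [and_comm]

theorem LocalParametrisation.measurableSet_image (p : LocalParametrisation I G d)
    {A : Set (EuclideanSpace ℝ (Fin d))} (hA : MeasurableSet A) (h : A ⊆ p.source) :
    MeasurableSet (p '' A) := by
  have h' : Measurable (p.target.domRestrict p.symm) :=
    (continuousOn_iff_continuous_domRestrict.1 p.symm.contMDiffOn.continuousOn).measurable
  convert p.open_target.measurableSet.subtype_image (h' hA)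
  rw [show p '' A = p.target ∩ p.symm ⁻¹' A from
    p.toPartialEquiv.image_eq_target_inter_inv_preimage h]
  ext u
  simpa using and_comm

theorem FormField.localMeasure_apply (Ω : FormField I G d) (p : LocalParametrisation I G d)
    {B : Set G} (hB : MeasurableSet B) :
    Ω.localMeasure p B = ∫⁻ u in p ⁻¹' B ∩ p.source, ENNReal.ofReal (Ω.density p u) := by
  have hp : AEMeasurable p (MeasureTheory.volume.restrict p.source) :=
    p.contMDiffOn.continuousOn.aemeasurable p.open_source.measurableSet
  have hm := p.measurableSet_preimage hB
  rw [FormField.localMeasure, MeasureTheory.Measure.map_apply_of_aemeasurable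
    (hp.mono_ac (MeasureTheory.withDensity_absolutelyContinuous _ _)) hB,
    ← MeasureTheory.restrict_withDensity p.open_source.measurableSet,
    MeasureTheory.Measure.restrict_apply' p.open_source.measurableSet,
    MeasureTheory.withDensity_apply _ hm]

theorem FormField.localMeasure_target_compl (Ω : FormField I G d)
    (p : LocalParametrisation I G d) : Ω.localMeasure p p.targetᶜ = 0 := by
  rw [Ω.localMeasure_apply p p.open_target.measurableSet.compl]
  have : p ⁻¹' p.targetᶜ ∩ p.source = ∅ := by
    ext u
    simp only [Set.mem_inter_iff, Set.mem_preimage, Set.mem_compl_iff, Set.mem_empty_iff_false,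
      iff_false, not_and]
    exact fun h1 h2 => h1 (p.map_source h2)
  rw [this, MeasureTheory.setLIntegral_empty]

/-- Two local measures agree on the overlap of the coordinate domains, by the change of variables
formula. -/
theorem FormField.localMeasure_eq_of_subset (Ω : FormField I G d)
    (q p : LocalParametrisation I G d) {B : Set G} (hB : MeasurableSet B)
    (hq : B ⊆ q.target) (hp : B ⊆ p.target) : Ω.localMeasure q B = Ω.localMeasure p B := by
  rw [Ω.localMeasure_apply q hB, Ω.localMeasure_apply p hB]
  have himage : p ⁻¹' B ∩ p.source = q.transition p '' (q ⁻¹' B ∩ q.source) := by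
    ext x
    constructor
    · rintro ⟨hx, hxs⟩
      refine ⟨p.transition q x, ⟨?_, q.map_target (hq hx)⟩, ?_⟩
      · change q (q.symm (p x)) ∈ B
        rw [show q (q.symm (p x)) = p x from q.right_inv (hq hx)]
        exact hx
      · change p.symm (q (q.symm (p x))) = x
        rw [show q (q.symm (p x)) = p x from q.right_inv (hq hx)]
        exact p.left_inv hxs
    · rintro ⟨u, ⟨hu, hus⟩, rfl⟩
      refine ⟨?_, p.map_target (hp hu)⟩
      change p (p.symm (q u)) ∈ B
      rw [show p (p.symm (q u)) = q u from p.right_inv (hp hu)]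
      exact hu
  have hinj : Set.InjOn (q.transition p) (q ⁻¹' B ∩ q.source) := by
    intro u hu v hv huv
    have h : q u = q v := p.symm.injOn (hp hu.1) (hp hv.1) huv
    exact q.injOn hu.2 hv.2 h
  rw [himage, MeasureTheory.lintegral_image_eq_lintegral_abs_det_fderiv_mul MeasureTheory.volume
    (q.measurableSet_preimage hB)
    (fun u hu => (((q.contDiffAt_transition p hu.2 (hp hu.1)).differentiableAt
      (by simp)).hasFDerivAt).hasFDerivWithinAt) hinj]
  refine MeasureTheory.setLIntegral_congr_fun (q.measurableSet_preimage hB) fun u hu => ?_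
  rw [← ENNReal.ofReal_mul (abs_nonneg _)]
  exact congrArg _ (Ω.density_eq_abs_det_mul q p hu.2 (hp hu.1))

/-- On the image of a parametrisation, the measure `|Ω|` is the local one: every local measure is
dominated by the measure that is given by `p` on the image of `p` and is infinite on every
nonempty set outside of it. -/
theorem FormField.measure_eq_localMeasure (Ω : FormField I G d) (p : LocalParametrisation I G d)
    {B : Set G} (hB : MeasurableSet B) (hp : B ⊆ p.target) :
    Ω.measure B = Ω.localMeasure p B := by
  refine le_antisymm ?_ (Ω.localMeasure_le p B)
  have hle : Ω.measure ≤ Ω.localMeasure p +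
      ((⊤ : ENNReal) • MeasureTheory.Measure.count).restrict p.targetᶜ := by
    refine iSup_le fun q => MeasureTheory.Measure.le_iff.2 fun s hs => ?_
    change Ω.localMeasure q s ≤ _
    rw [MeasureTheory.Measure.add_apply, MeasureTheory.Measure.restrict_apply hs]
    rcases (s ∩ p.targetᶜ).eq_empty_or_nonempty with h | h
    · refine le_trans ?_ le_self_add
      have hsp : s ⊆ p.target := by
        intro x hx
        by_contra hx'
        exact (h ▸ (⟨hx, hx'⟩ : x ∈ s ∩ p.targetᶜ) : x ∈ (∅ : Set G))
      have hqm := q.open_target.measurableSet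
      calc Ω.localMeasure q s
          ≤ Ω.localMeasure q (s ∩ q.target) + Ω.localMeasure q q.targetᶜ :=
            (MeasureTheory.measure_mono fun x hx => by
              by_cases hxq : x ∈ q.target
              · exact Or.inl ⟨hx, hxq⟩
              · exact Or.inr hxq).trans (MeasureTheory.measure_union_le _ _)
        _ = Ω.localMeasure p (s ∩ q.target) := by
            rw [Ω.localMeasure_target_compl q, add_zero,
              Ω.localMeasure_eq_of_subset q p (hs.inter hqm) Set.inter_subset_right
                (Set.inter_subset_left.trans hsp)]
        _ ≤ Ω.localMeasure p s := MeasureTheory.measure_mono Set.inter_subset_left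
    · have : ((⊤ : ENNReal) • MeasureTheory.Measure.count) (s ∩ p.targetᶜ) = ⊤ := by
        rw [MeasureTheory.Measure.smul_apply, smul_eq_mul, ENNReal.top_mul]
        rw [Ne, MeasureTheory.Measure.count_eq_zero_iff]
        exact h.ne_empty
      rw [this]
      simp
  refine (hle B).trans ?_
  rw [MeasureTheory.Measure.add_apply, MeasureTheory.Measure.restrict_apply hB]
  have : B ∩ p.targetᶜ = ∅ := Set.disjoint_iff_inter_eq_empty.1
    (Set.disjoint_compl_right_iff_subset.2 hp)
  simp [this]

/-- The measure `|Ω|` in coordinates. -/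
theorem FormField.measure_image (Ω : FormField I G d) (p : LocalParametrisation I G d)
    {A : Set (EuclideanSpace ℝ (Fin d))} (hA : MeasurableSet A) (h : A ⊆ p.source) :
    Ω.measure (p '' A) = ∫⁻ u in A, ENNReal.ofReal (Ω.density p u) := by
  have hm := p.measurableSet_image hA h
  rw [Ω.measure_eq_localMeasure p hm, Ω.localMeasure_apply p hm]
  · congr 2
    ext u
    constructor
    · rintro ⟨⟨v, hv, hvu⟩, hu⟩
      rwa [← p.injOn (h hv) hu hvu]
    · exact fun hu => ⟨⟨u, hu, rfl⟩, h hu⟩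
  · rintro _ ⟨u, hu, rfl⟩
    exact p.map_source (h hu)

theorem FormField.measure_smul_le (Ω : FormField I G d) (c : ℝ) :
    FormField.measure (fun g => c • Ω g) ≤ ENNReal.ofReal |c| • Ω.measure := by
  refine iSup_le fun p => MeasureTheory.Measure.le_iff.2 fun s hs => ?_
  change FormField.localMeasure (fun g => c • Ω g) p s ≤ _
  rw [FormField.localMeasure_apply _ p hs, MeasureTheory.Measure.smul_apply, smul_eq_mul]
  refine le_trans (le_of_eq ?_) (mul_le_mul_right (Ω.localMeasure_le p s) _)
  rw [FormField.localMeasure_apply _ p hs, ← MeasureTheory.lintegral_const_mul']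
  · refine MeasureTheory.lintegral_congr fun u => ?_
    rw [← ENNReal.ofReal_mul (abs_nonneg c)]
    congr 1
    exact abs_mul c _
  · exact ENNReal.ofReal_ne_top

theorem FormField.measure_smul (Ω : FormField I G d) {c : ℝ} (hc : c ≠ 0) :
    FormField.measure (fun g => c • Ω g) = ENNReal.ofReal |c| • Ω.measure := by
  refine le_antisymm (Ω.measure_smul_le c) ?_
  have h : Ω = fun g => c⁻¹ • (fun g => c • Ω g : FormField I G d) g := by
    funext g
    exact (inv_smul_smul₀ hc (Ω g)).symm
  have h1 := FormField.measure_smul_le (fun g => c • Ω g : FormField I G d) c⁻¹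
  rw [← h] at h1
  refine MeasureTheory.Measure.le_iff.2 fun s _ => ?_
  have h2 := mul_le_mul_right (h1 s) (ENNReal.ofReal |c|)
  rw [MeasureTheory.Measure.smul_apply, smul_eq_mul, ← mul_assoc,
    ← ENNReal.ofReal_mul (abs_nonneg c), ← abs_mul, mul_inv_cancel₀ hc] at h2
  simpa using h2

end Manifold

section LieGroup

variable {E : Type*} [NormedAddCommGroup E] [NormedSpace ℝ E]
  {H : Type*} [TopologicalSpace H] {I : ModelWithCorners ℝ E H}
  {G : Type*} [TopologicalSpace G] [ChartedSpace H G] [Group G] {d : ℕ}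

/-! ### Left invariant forms -/

/-- The derivative at `h` of the left translation by `g`, as an endomorphism of the model space. -/
def leftTranslationDeriv (I : ModelWithCorners ℝ E H) (g h : G) : E →L[ℝ] E :=
  mfderiv I I (fun x : G => g * x) h

theorem leftTranslationDeriv_one (h : G) :
    leftTranslationDeriv I 1 h = ContinuousLinearMap.id ℝ E := by
  have : (fun x : G => 1 * x) = id := by funext x; exact one_mul x
  rw [leftTranslationDeriv, this]
  exact mfderiv_id

/-- Left invariance, `L_g^* Ω = Ω`, tested on vectors of the model space. -/
def FormField.IsLeftInvariant (Ω : FormField I G d) : Prop :=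
  ∀ (g h : G) (v : Fin d → E),
    Ω.eval (g * h) (fun i => leftTranslationDeriv I g h (v i)) = Ω.eval h v

/-- An invariant form is determined by its value at the identity. -/
theorem FormField.IsLeftInvariant.eval_eq {Ω : FormField I G d} (hΩ : Ω.IsLeftInvariant) (g : G)
    (v : Fin d → E) :
    Ω.eval g v = Ω.eval 1 (fun i => leftTranslationDeriv I g⁻¹ g (v i)) := by
  have h := hΩ g⁻¹ g v
  rw [inv_mul_cancel] at h
  exact h.symm

variable [LieGroup I ∞ G]

theorem mdifferentiableAt_leftTranslation (g h : G) :
    MDifferentiableAt I I (fun x : G => g * x) h :=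
  (contMDiff_mul_left (I := I) (n := ∞) (a := g)).mdifferentiableAt (by simp)

theorem leftTranslationDeriv_mul (a b h : G) :
    leftTranslationDeriv I (a * b) h =
      (leftTranslationDeriv I a (b * h)).comp (leftTranslationDeriv I b h) := by
  have : (fun x : G => a * b * x) = (fun x => a * x) ∘ (fun x => b * x) := by
    funext x; exact mul_assoc a b x
  rw [leftTranslationDeriv, this]
  exact mfderiv_comp h (mdifferentiableAt_leftTranslation a (b * h))
    (mdifferentiableAt_leftTranslation b h)

theorem leftTranslationDeriv_inv_apply (g h : G) (v : E) :
    leftTranslationDeriv I g⁻¹ (g * h) (leftTranslationDeriv I g h v) = v := by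
  have := leftTranslationDeriv_mul (I := I) g⁻¹ g h
  rw [inv_mul_cancel, leftTranslationDeriv_one] at this
  exact (DFunLike.congr_fun this v).symm

/-- A parametrisation followed by a left translation. -/
def LocalParametrisation.translate (p : LocalParametrisation I G d) (g : G) :
    LocalParametrisation I G d where
  toPartialEquiv := p.toPartialEquiv.transEquiv (Equiv.mulLeft g)
  open_source := p.open_source
  open_target := by
    have : Continuous fun x : G => g⁻¹ * x :=
      (contMDiff_mul_left (I := I) (n := ∞) (a := g⁻¹)).continuous
    exact p.open_target.preimage this
  contMDiffOn_toFun :=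
    (contMDiff_mul_left (I := I) (n := ∞) (a := g)).comp_contMDiffOn p.contMDiffOn
  contMDiffOn_invFun :=
    p.symm.contMDiffOn.comp (contMDiff_mul_left (I := I) (n := ∞) (a := g⁻¹)).contMDiffOn
      fun _ hx => hx

theorem LocalParametrisation.translate_apply (p : LocalParametrisation I G d) (g : G)
    (u : EuclideanSpace ℝ (Fin d)) : p.translate g u = g * p u := rfl

theorem FormField.IsLeftInvariant.density_translate {Ω : FormField I G d}
    (hΩ : Ω.IsLeftInvariant) (p : LocalParametrisation I G d) (g : G)
    {u : EuclideanSpace ℝ (Fin d)} (hu : u ∈ p.source) :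
    Ω.density (p.translate g) u = Ω.density p u := by
  have h : (mfderiv 𝓘(ℝ, EuclideanSpace ℝ (Fin d)) I (p.translate g) u :
      EuclideanSpace ℝ (Fin d) →L[ℝ] E) = (leftTranslationDeriv I g (p u)).comp
        (mfderiv 𝓘(ℝ, EuclideanSpace ℝ (Fin d)) I p u : EuclideanSpace ℝ (Fin d) →L[ℝ] E) :=
    mfderiv_comp u (mdifferentiableAt_leftTranslation g (p u)) (p.mdifferentiableAt hu)
  have h1 : (LocalParametrisation.partialDeriv (p.translate g) u : Fin d → E) =
      fun j => leftTranslationDeriv I g (p u) (p.partialDeriv u j) := by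
    funext j
    exact DFunLike.congr_fun h _
  change |Ω.eval (g * p u) (LocalParametrisation.partialDeriv (p.translate g) u)| = _
  rw [h1]
  exact congrArg abs (hΩ g (p u) (LocalParametrisation.partialDeriv p u))

/-! ### Invariance and finiteness of the measure -/

/-- The density of an invariant form is continuous: at `u` near `u₀` it is `|det D(T_u)_u|` times
its value at `u₀`, where `T_u` is the left translation that moves `p u` to `p u₀`, read in the
coordinates given by `p`. -/
theorem FormField.IsLeftInvariant.continuousAt_density {Ω : FormField I G d}
    (hΩ : Ω.IsLeftInvariant) (p : LocalParametrisation I G d) {u₀ : EuclideanSpace ℝ (Fin d)}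
    (hu₀ : u₀ ∈ p.source) : ContinuousAt (Ω.density p) u₀ := by
  let F : EuclideanSpace ℝ (Fin d) → EuclideanSpace ℝ (Fin d) → EuclideanSpace ℝ (Fin d) :=
    fun u => (p.translate (p u₀ * (p u)⁻¹)).transition p
  have hdens : ∀ u ∈ p.source,
      Ω.density p u = |(fderiv ℝ (F u) u).det| * Ω.density p u₀ := by
    intro u hu
    have h1 : p.translate (p u₀ * (p u)⁻¹) u = p u₀ := by
      rw [LocalParametrisation.translate_apply, inv_mul_cancel_right]
    have h2 : (p.translate (p u₀ * (p u)⁻¹)).transition p u = u₀ := by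
      change p.symm (p.translate (p u₀ * (p u)⁻¹) u) = u₀
      rw [h1]
      exact p.left_inv hu₀
    have h := Ω.density_eq_abs_det_mul (p.translate (p u₀ * (p u)⁻¹)) p (u := u) hu
      (by rw [h1]; exact p.map_source hu₀)
    rw [hΩ.density_translate p _ hu, h2] at h
    exact h
  have hp : ContMDiffAt 𝓘(ℝ, EuclideanSpace ℝ (Fin d)) I ∞ p u₀ :=
    (p.contMDiffOn u₀ hu₀).contMDiffAt (p.open_source.mem_nhds hu₀)
  have hF : ContDiffAt ℝ ∞ (Function.uncurry F) (u₀, u₀) := by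
    have h1 : ContMDiffAt 𝓘(ℝ, EuclideanSpace ℝ (Fin d) × EuclideanSpace ℝ (Fin d)) I ∞
        (fun z : EuclideanSpace ℝ (Fin d) × EuclideanSpace ℝ (Fin d) => p z.1) (u₀, u₀) :=
      ContMDiffAt.comp_of_eq hp contDiff_fst.contMDiff.contMDiffAt rfl
    have h2 : ContMDiffAt 𝓘(ℝ, EuclideanSpace ℝ (Fin d) × EuclideanSpace ℝ (Fin d)) I ∞
        (fun z : EuclideanSpace ℝ (Fin d) × EuclideanSpace ℝ (Fin d) => p z.2) (u₀, u₀) :=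
      ContMDiffAt.comp_of_eq hp contDiff_snd.contMDiff.contMDiffAt rfl
    have h3 := ((contMDiffAt_const (c := p u₀)).mul h1.inv).mul h2
    have h4 : ContMDiffAt I 𝓘(ℝ, EuclideanSpace ℝ (Fin d)) ∞ p.symm
        (p u₀ * (p u₀)⁻¹ * p u₀) := by
      rw [inv_mul_cancel_right]
      exact (p.symm.contMDiffOn _ (p.map_source hu₀)).contMDiffAt
        (p.open_target.mem_nhds (p.map_source hu₀))
    exact (h4.comp (u₀, u₀) h3).contDiffAt
  -- The derivative in the second variable of the jointly smooth `F`, on the diagonal.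
  have hcont : ContinuousAt (fun u => fderiv ℝ (F u) u) u₀ :=
    (ContDiffAt.fderiv (m := 0) (n := ∞) hF contDiffAt_id (by simp)).continuousAt
  have hcont' : ContinuousAt (fun u => |(fderiv ℝ (F u) u).det| * Ω.density p u₀) u₀ :=
    ((ContinuousLinearMap.continuous_det.continuousAt.comp hcont).abs).mul continuousAt_const
  exact hcont'.congr (by
    filter_upwards [p.open_source.mem_nhds hu₀] with u hu
    exact (hdens u hu).symm)

variable [MeasurableSpace G] [BorelSpace G]

theorem FormField.IsLeftInvariant.map_localMeasure {Ω : FormField I G d}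
    (hΩ : Ω.IsLeftInvariant) (p : LocalParametrisation I G d) (g : G) :
    (Ω.localMeasure p).map (fun x => g * x) = Ω.localMeasure (p.translate g) := by
  have hc : Continuous fun x : G => g * x :=
    (contMDiff_mul_left (I := I) (n := ∞) (a := g)).continuous
  refine MeasureTheory.Measure.ext fun s hs => ?_
  rw [MeasureTheory.Measure.map_apply hc.measurable hs,
    Ω.localMeasure_apply p (hc.measurable hs), Ω.localMeasure_apply (p.translate g) hs]
  refine MeasureTheory.setLIntegral_congr_fun (p.measurableSet_preimage (hc.measurable hs))
    fun u hu => ?_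
  exact congrArg ENNReal.ofReal (hΩ.density_translate p g hu.2).symm

theorem FormField.IsLeftInvariant.isMulLeftInvariant {Ω : FormField I G d}
    (hΩ : Ω.IsLeftInvariant) : Ω.measure.IsMulLeftInvariant := by
  have hc (g : G) : Measurable fun x : G => g * x :=
    (contMDiff_mul_left (I := I) (n := ∞) (a := g)).continuous.measurable
  have hle (g : G) : Ω.measure ≤ Ω.measure.map (fun x => g * x) := by
    refine iSup_le fun q => ?_
    have hq : (q.translate g⁻¹).translate g = q := by
      have h : (q.toPartialEquiv.transEquiv (Equiv.mulLeft g⁻¹)).transEquiv (Equiv.mulLeft g) =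
          q.toPartialEquiv := by
        ext x <;> simp
      cases q
      simp only [LocalParametrisation.translate] at h ⊢
      congr
    change Ω.localMeasure q ≤ _
    rw [← hq, ← hΩ.map_localMeasure]
    exact MeasureTheory.Measure.map_mono (Ω.localMeasure_le _) (hc g)
  refine ⟨fun g => le_antisymm ?_ (hle g)⟩
  have h := MeasureTheory.Measure.map_mono (hle g⁻¹) (hc g)
  rw [MeasureTheory.Measure.map_map (hc g) (hc g⁻¹)] at h
  have hid : ((fun x : G => g * x) ∘ fun x => g⁻¹ * x) = id := by
    funext x; simp
  rwa [hid, MeasureTheory.Measure.map_id] at h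

/-- If the density of an invariant form is positive at some point, the measure of a suitable
nonempty open set is positive and finite. -/
theorem FormField.IsLeftInvariant.exists_measure_pos_lt_top {Ω : FormField I G d}
    (hΩ : Ω.IsLeftInvariant) (p : LocalParametrisation I G d) {u₀ : EuclideanSpace ℝ (Fin d)}
    (hu₀ : u₀ ∈ p.source) (hpos : 0 < Ω.density p u₀) :
    ∃ V : Set G, IsOpen V ∧ V.Nonempty ∧ 0 < Ω.measure V ∧ Ω.measure V < ⊤ := by
  have hc := hΩ.continuousAt_density p hu₀
  have h1 := hc.eventually (lt_mem_nhds (half_lt_self hpos))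
  have h2 := hc.eventually (gt_mem_nhds (lt_add_one (Ω.density p u₀)))
  obtain ⟨ε, hε, hball⟩ := Metric.eventually_nhds_iff_ball.1
    ((h1.and h2).and (p.open_source.mem_nhds hu₀))
  have hsub : Metric.ball u₀ ε ⊆ p.source := fun u hu => (hball u hu).2
  refine ⟨p '' Metric.ball u₀ ε, p.isOpen_image Metric.isOpen_ball hsub,
    ⟨_, u₀, Metric.mem_ball_self hε, rfl⟩, ?_, ?_⟩
  · rw [Ω.measure_image p measurableSet_ball hsub]
    calc (0 : ENNReal) < ENNReal.ofReal (Ω.density p u₀ / 2) *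
          MeasureTheory.volume (Metric.ball u₀ ε) :=
          ENNReal.mul_pos (by simpa using hpos) (Metric.measure_ball_pos _ _ hε).ne'
      _ = ∫⁻ _ in Metric.ball u₀ ε, ENNReal.ofReal (Ω.density p u₀ / 2) := by simp
      _ ≤ _ := MeasureTheory.setLIntegral_mono' measurableSet_ball fun u hu =>
          ENNReal.ofReal_le_ofReal (hball u hu).1.1.le
  · rw [Ω.measure_image p measurableSet_ball hsub]
    calc _ ≤ ∫⁻ _ in Metric.ball u₀ ε, ENNReal.ofReal (Ω.density p u₀ + 1) :=
          MeasureTheory.setLIntegral_mono' measurableSet_ball fun u hu =>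
            ENNReal.ofReal_le_ofReal (hball u hu).1.2.le
      _ = ENNReal.ofReal (Ω.density p u₀ + 1) * MeasureTheory.volume (Metric.ball u₀ ε) := by simp
      _ < ⊤ := ENNReal.mul_lt_top ENNReal.ofReal_lt_top MeasureTheory.measure_ball_lt_top

end LieGroup

section LieGroup

variable {E : Type*} [NormedAddCommGroup E] [NormedSpace ℝ E]
  {H : Type*} [TopologicalSpace H] {I : ModelWithCorners ℝ E H}
  {G : Type*} [TopologicalSpace G] [ChartedSpace H G] {d : ℕ}

/-! ### Existence of parametrisations and positivity of densities -/

/-- Charts of `G`, read in coordinates of `E`, are local parametrisations. -/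
theorem exists_localParametrisation [FiniteDimensional ℝ E] [I.Boundaryless] [IsManifold I ∞ G]
    (hd : Module.finrank ℝ E = d) (g : G) :
    ∃ (p : LocalParametrisation I G d) (u : EuclideanSpace ℝ (Fin d)), u ∈ p.source := by
  let e : EuclideanSpace ℝ (Fin d) ≃L[ℝ] E := ContinuousLinearEquiv.ofFinrankEq (by simp [hd])
  let p : LocalParametrisation I G d :=
    { toPartialEquiv := e.toEquiv.transPartialEquiv (extChartAt I g).symm
      open_source := (isOpen_extChartAt_target g).preimage e.continuous
      open_target := isOpen_extChartAt_source g
      contMDiffOn_toFun := (contMDiffOn_extChartAt_symm g).comp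
        e.contDiff.contMDiff.contMDiffOn fun _ hu => hu
      contMDiffOn_invFun := by
        have h := contMDiffOn_extChartAt (I := I) (n := ∞) (x := g)
        rw [← extChartAt_source I] at h
        exact e.symm.contDiff.contMDiff.comp_contMDiffOn h }
  refine ⟨p, e.symm (extChartAt I g g), ?_⟩
  change e (e.symm (extChartAt I g g)) ∈ (extChartAt I g).target
  rw [e.apply_symm_apply]
  exact mem_extChartAt_target g

theorem FormField.density_pos {Ω : FormField I G d} (hΩ : ∀ g, Ω g ≠ 0)
    (p : LocalParametrisation I G d) {u : EuclideanSpace ℝ (Fin d)} (hu : u ∈ p.source) :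
    0 < Ω.density p u := by
  let L := (PartialDiffeomorph.isLocalDiffeomorphAt _ _ _ p hu).mfderivToContinuousLinearEquiv
    (by simp)
  let b := (EuclideanSpace.basisFun (Fin d) ℝ).toBasis.map L.toLinearEquiv
  have hb : LocalParametrisation.partialDeriv p u = b := by
    funext j
    change _ = L ((EuclideanSpace.basisFun (Fin d) ℝ).toBasis j)
    simp only [OrthonormalBasis.coe_toBasis, EuclideanSpace.basisFun_apply]
    rfl
  rw [FormField.density, hb, abs_pos]
  exact ((Ω (p u)).map_basis_ne_zero_iff b).2 (hΩ (p u))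

/-! ### The form `θ¹ ∧ ⋯ ∧ θ^d` -/

variable [Group G]

theorem IsHaarVolumeForm.isLeftInvariant [MeasurableSpace G] {Ω : FormField I G d}
    (h : IsHaarVolumeForm Ω) : Ω.IsLeftInvariant :=
  fun g x v => DFunLike.congr_fun (h.leftInvariant g x) v

theorem FormField.IsLeftInvariant.smul {Ω : FormField I G d} (hΩ : Ω.IsLeftInvariant) (c : ℝ) :
    FormField.IsLeftInvariant (fun g => c • Ω g) :=
  fun g h v => congrArg (c * ·) (hΩ g h v)

theorem maurerCartanVolume_eval (ξ : Module.Basis (Fin d) ℝ (GroupLieAlgebra I G)) (g : G)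
    (v : Fin d → E) :
    (maurerCartanVolume ξ).eval g v = Matrix.det (Matrix.of fun i j =>
      ξ.coord i (leftTranslationDeriv I g⁻¹ g (v j))) :=
  wedgeOneForms_apply (fun i => maurerCartanComponent ξ i g) v

theorem maurerCartanVolume_eval_one (ξ : Module.Basis (Fin d) ℝ (GroupLieAlgebra I G)) :
    (maurerCartanVolume ξ).eval 1 ξ = 1 := by
  refine (maurerCartanVolume_eval ξ 1 ξ).trans ?_
  rw [inv_one, leftTranslationDeriv_one]
  convert Matrix.det_one (n := Fin d) (R := ℝ)
  ext i j
  rw [Matrix.of_apply, Matrix.one_apply]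
  refine (ξ.coord_apply i _).trans ?_
  refine (congrFun (congrArg DFunLike.coe (ξ.repr_self j)) i).trans ?_
  simp [Finsupp.single_apply, eq_comm]

variable [LieGroup I ∞ G]

theorem maurerCartanVolume_isLeftInvariant
    (ξ : Module.Basis (Fin d) ℝ (GroupLieAlgebra I G)) :
    (maurerCartanVolume ξ).IsLeftInvariant := by
  intro g h v
  have key : ∀ w : E, leftTranslationDeriv I (g * h)⁻¹ (g * h) (leftTranslationDeriv I g h w) =
      leftTranslationDeriv I h⁻¹ h w := by
    intro w
    rw [mul_inv_rev, leftTranslationDeriv_mul, inv_mul_cancel_left,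
      ContinuousLinearMap.comp_apply, leftTranslationDeriv_inv_apply]
  simp only [maurerCartanVolume_eval, key]

theorem maurerCartanVolume_ne_zero (ξ : Module.Basis (Fin d) ℝ (GroupLieAlgebra I G)) (g : G) :
    maurerCartanVolume ξ g ≠ 0 := by
  intro h0
  have h := maurerCartanVolume_isLeftInvariant ξ g 1 ξ
  rw [maurerCartanVolume_eval_one, mul_one] at h
  have h0' : ∀ v : Fin d → E, (maurerCartanVolume ξ).eval g v = 0 :=
    fun v => DFunLike.congr_fun h0 v
  rw [h0'] at h
  exact zero_ne_one h

/-- Every left invariant form of top degree is a constant multiple of `θ¹ ∧ ⋯ ∧ θ^d`. -/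
theorem FormField.IsLeftInvariant.exists_eq_smul {Ω : FormField I G d} (hΩ : Ω.IsLeftInvariant)
    (ξ : Module.Basis (Fin d) ℝ (GroupLieAlgebra I G)) :
    ∃ c : ℝ, ∀ g, Ω g = c • maurerCartanVolume ξ g := by
  have h1 : ∀ v : Fin d → E,
      Ω.eval 1 v = Ω.eval 1 ξ * (maurerCartanVolume ξ).eval 1 v := by
    intro v
    have h2 : Ω.eval 1 v = Ω.eval 1 ξ * ξ.det v :=
      DFunLike.congr_fun ((Ω 1).eq_smul_basis_det ξ) v
    have h3 : (maurerCartanVolume ξ).eval 1 v = (maurerCartanVolume ξ).eval 1 ξ * ξ.det v :=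
      DFunLike.congr_fun ((maurerCartanVolume ξ 1).eq_smul_basis_det ξ) v
    rw [h2, h3, maurerCartanVolume_eval_one, one_mul]
  refine ⟨Ω.eval 1 ξ, fun g => AlternatingMap.ext fun v => ?_⟩
  exact (hΩ.eval_eq g v).trans ((h1 _).trans (congrArg (Ω.eval 1 ξ * ·)
    ((maurerCartanVolume_isLeftInvariant ξ).eval_eq g v).symm))

/-- The left invariant measure given by a nowhere vanishing left invariant form on a compact Lie
group has positive and finite total mass. -/
theorem FormField.IsLeftInvariant.measure_univ_pos_lt_top [FiniteDimensional ℝ E]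
    [I.Boundaryless] [CompactSpace G] [MeasurableSpace G] [BorelSpace G]
    {Ω : FormField I G d} (hΩ : Ω.IsLeftInvariant) (h0 : ∀ g, Ω g ≠ 0)
    (hd : Module.finrank ℝ E = d) : 0 < Ω.measure Set.univ ∧ Ω.measure Set.univ < ⊤ := by
  have : IsTopologicalGroup G := topologicalGroup_of_lieGroup I ∞
  have := hΩ.isMulLeftInvariant
  obtain ⟨p, u, hu⟩ := exists_localParametrisation (I := I) hd (1 : G)
  obtain ⟨V, hVo, hVn, hV0, hV⟩ := hΩ.exists_measure_pos_lt_top p hu (FormField.density_pos h0 p hu)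
  exact ⟨hV0.trans_le (MeasureTheory.measure_mono (Set.subset_univ V)),
    MeasureTheory.measure_lt_top_of_isCompact_of_isMulLeftInvariant V hVo hVn hV.ne
      isCompact_univ⟩

end LieGroup

/-! ### Matrix groups -/

section MatrixGroup

variable {E : Type*} [NormedAddCommGroup E] [NormedSpace ℝ E]
  {H : Type*} [TopologicalSpace H] {I : ModelWithCorners ℝ E H}
  {G : Type*} [TopologicalSpace G] [ChartedSpace H G] {d D : ℕ}

theorem matrixPartialDeriv_eq {F : G → Matrix (Fin D) (Fin D) ℝ}
    (hF : ∀ a b : Fin D, ContMDiff I 𝓘(ℝ, ℝ) ∞ fun g : G => F g a b)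
    (p : LocalParametrisation I G d) {u : EuclideanSpace ℝ (Fin d)} (hu : u ∈ p.source)
    (j : Fin d) :
    matrixPartialDeriv (fun w => F (p w)) u j =
      matrixDeriv F (p u) (LocalParametrisation.partialDeriv p u j) := by
  ext a b
  have h := mfderiv_comp u ((hF a b).mdifferentiableAt (by simp)) (p.mdifferentiableAt hu)
  rw [mfderiv_eq_fderiv] at h
  exact DFunLike.congr_fun h (EuclideanSpace.single j (1 : ℝ))

/-- The derivative of a scalar function on `G`, as a linear form on the model space. -/
def scalarDeriv (I : ModelWithCorners ℝ E H) (f : G → ℝ) (g : G) : E →L[ℝ] ℝ :=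
  mfderiv I 𝓘(ℝ, ℝ) f g

variable [Group G]

/-- If `ξ` is orthonormal, its dual basis is given by the scalar products with `ξ`. -/
theorem frobeniusInner_matrixDeriv_eq_coord (F : G → Matrix (Fin D) (Fin D) ℝ)
    (ξ : Module.Basis (Fin d) ℝ (GroupLieAlgebra I G))
    (horth : ∀ i j : Fin d, frobeniusInner (matrixDeriv F (1 : G) (ξ i))
      (matrixDeriv F (1 : G) (ξ j)) = if i = j then 1 else 0)
    (i : Fin d) (Y : GroupLieAlgebra I G) :
    frobeniusInner (matrixDeriv F (1 : G) Y) (matrixDeriv F (1 : G) (ξ i)) = ξ.coord i Y := by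
  let φ : GroupLieAlgebra I G →ₗ[ℝ] ℝ :=
    { toFun := fun Y => frobeniusInner (matrixDeriv F (1 : G) Y) (matrixDeriv F (1 : G) (ξ i))
      map_add' := fun Y Z => by
        have : matrixDeriv F (1 : G) (Y + Z) =
            matrixDeriv F (1 : G) Y + matrixDeriv F (1 : G) Z := by
          ext a b
          exact (scalarDeriv I (fun h => F h a b) 1).map_add Y Z
        rw [this, frobeniusInner, add_mul, Matrix.trace_add, mul_add]
        rfl
      map_smul' := fun c Y => by
        have : matrixDeriv F (1 : G) (c • Y) = c • matrixDeriv F (1 : G) Y := by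
          ext a b
          exact (scalarDeriv I (fun h => F h a b) 1).map_smul c Y
        rw [this, frobeniusInner, smul_mul_assoc, Matrix.trace_smul, mul_smul_comm]
        rfl }
  have h : φ = ξ.coord i := by
    refine ξ.ext fun j => ?_
    refine (horth j i).trans ?_
    rw [ξ.coord_apply, ξ.repr_self, Finsupp.single_apply]
  exact DFunLike.congr_fun h Y

variable [LieGroup I ∞ G]

theorem scalarDeriv_comp_leftTranslation {f : G → ℝ} (hf : ContMDiff I 𝓘(ℝ, ℝ) ∞ f) (g : G) :
    scalarDeriv I (fun x => f (g⁻¹ * x)) g =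
      (scalarDeriv I f 1).comp (leftTranslationDeriv I g⁻¹ g) := by
  have h : scalarDeriv I (fun x => f (g⁻¹ * x)) g =
      (scalarDeriv I f (g⁻¹ * g)).comp (leftTranslationDeriv I g⁻¹ g) :=
    mfderiv_comp g (hf.mdifferentiableAt (by simp)) (mdifferentiableAt_leftTranslation g⁻¹ g)
  rwa [inv_mul_cancel] at h

/-- The Maurer-Cartan form of a matrix group is `g⁻¹ dg`. -/
theorem matrixDeriv_leftMaurerCartan (ρ : G →* Matrix.GeneralLinearGroup (Fin D) ℝ)
    (hρ : ∀ a b : Fin D, ContMDiff I 𝓘(ℝ, ℝ) ∞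
      fun g : G => (ρ g : Matrix (Fin D) (Fin D) ℝ) a b) (g : G) (X : TangentSpace I g) :
    matrixDeriv (fun h : G => (ρ h : Matrix (Fin D) (Fin D) ℝ)) (1 : G) (leftMaurerCartan g X) =
      (ρ g : Matrix (Fin D) (Fin D) ℝ)⁻¹ *
        matrixDeriv (fun h : G => (ρ h : Matrix (Fin D) (Fin D) ℝ)) g X := by
  ext a b
  have h1 := DFunLike.congr_fun (scalarDeriv_comp_leftTranslation (hρ a b) g) X
  have h2 : (fun x : G => (ρ (g⁻¹ * x) : Matrix (Fin D) (Fin D) ℝ) a b) =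
      ∑ c, ((ρ g : Matrix (Fin D) (Fin D) ℝ)⁻¹ a c) •
        fun x : G => (ρ x : Matrix (Fin D) (Fin D) ℝ) c b := by
    funext x
    rw [map_mul, map_inv, Units.val_mul, Matrix.coe_units_inv, Matrix.mul_apply,
      Finset.sum_apply]
    rfl
  have h3 : scalarDeriv I (fun x : G => (ρ (g⁻¹ * x) : Matrix (Fin D) (Fin D) ℝ) a b) g =
      ∑ c, ((ρ g : Matrix (Fin D) (Fin D) ℝ)⁻¹ a c) •
        scalarDeriv I (fun x : G => (ρ x : Matrix (Fin D) (Fin D) ℝ) c b) g := by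
    rw [h2]
    exact (HasMFDerivAt.sum fun c _ =>
      (((hρ c b).mdifferentiableAt (by simp)).hasMFDerivAt (x := g)).const_smul _).mfderiv
  rw [h3] at h1
  refine h1.symm.trans ?_
  rw [Matrix.mul_apply]
  exact (sum_apply _ _ (X : E)).trans rfl

end MatrixGroup

end

/-! ### The Haar volume form and the Haar measure -/

theorem theorem2p1
    {E : Type*} [NormedAddCommGroup E] [NormedSpace ℝ E] [FiniteDimensional ℝ E]
    {H : Type*} [TopologicalSpace H] (I : ModelWithCorners ℝ E H) [I.Boundaryless]
    (G : Type*) [TopologicalSpace G] [ChartedSpace H G] [Group G] [LieGroup I ∞ G]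
    [CompactSpace G] [T2Space G] [MeasurableSpace G] [BorelSpace G]
    -- the Haar probability measure of `G`
    (μ : MeasureTheory.Measure G) [MeasureTheory.IsProbabilityMeasure μ]
    [MeasureTheory.Measure.IsMulLeftInvariant μ]
    -- a basis of the Lie algebra
    (d : ℕ) (ξ : Module.Basis (Fin d) ℝ (GroupLieAlgebra I G)) :
    ∃ C : ℝ, 0 < C ∧
      -- `C` is the integral of `θ¹ ∧ ⋯ ∧ θ^d` over `G`
      FormField.measure (maurerCartanVolume ξ) Set.univ = ENNReal.ofReal C ∧
      -- `C⁻¹ θ¹ ∧ ⋯ ∧ θ^d` is, up to its sign, the Haar volume form, and defines the Haar measure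
      IsHaarVolumeForm (fun g => C⁻¹ • maurerCartanVolume ξ g) ∧
      (∀ Ω : FormField I G d, IsHaarVolumeForm Ω →
        (∀ g, Ω g = C⁻¹ • maurerCartanVolume ξ g) ∨
        (∀ g, Ω g = -(C⁻¹ • maurerCartanVolume ξ g))) ∧
      FormField.measure (fun g => C⁻¹ • maurerCartanVolume ξ g) = μ ∧
      -- the local expression, for volume forms and for measures
      (∀ p : LocalParametrisation I G d,
        (∀ u ∈ p.source,
          FormField.pullback (fun g => C⁻¹ • maurerCartanVolume ξ g) p u =
            (C⁻¹ * Matrix.det (Matrix.of fun i j : Fin d =>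
                maurerCartanComponent ξ i (p u) (LocalParametrisation.partialDeriv p u j))) •
              coordinateVolumeForm d) ∧
        (∀ A : Set (EuclideanSpace ℝ (Fin d)), MeasurableSet A → A ⊆ p.source →
          μ (p '' A) = ∫⁻ u in A, ENNReal.ofReal
            |C⁻¹ * Matrix.det (Matrix.of fun i j : Fin d =>
                maurerCartanComponent ξ i (p u) (LocalParametrisation.partialDeriv p u j))|)) ∧
      -- the case of matrix groups
      (∀ (D : ℕ) (ρ : G →* Matrix.GeneralLinearGroup (Fin D) ℝ), Function.Injective ρ →
        (∀ a b : Fin D, ContMDiff I 𝓘(ℝ, ℝ) ∞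
          fun g : G => (ρ g : Matrix (Fin D) (Fin D) ℝ) a b) →
        (∀ (g : G) (X : TangentSpace I g),
          matrixDeriv (fun h : G => (ρ h : Matrix (Fin D) (Fin D) ℝ)) (1 : G)
              (leftMaurerCartan g X) =
            (ρ g : Matrix (Fin D) (Fin D) ℝ)⁻¹ *
              matrixDeriv (fun h : G => (ρ h : Matrix (Fin D) (Fin D) ℝ)) g X) ∧
        ((∀ i j : Fin d,
          frobeniusInner
            (matrixDeriv (fun h : G => (ρ h : Matrix (Fin D) (Fin D) ℝ)) (1 : G) (ξ i))
            (matrixDeriv (fun h : G => (ρ h : Matrix (Fin D) (Fin D) ℝ)) (1 : G) (ξ j)) =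
              if i = j then 1 else 0) →
          ∀ p : LocalParametrisation I G d, ∀ u ∈ p.source,
            C⁻¹ * Matrix.det (Matrix.of fun i j : Fin d =>
                maurerCartanComponent ξ i (p u) (LocalParametrisation.partialDeriv p u j)) =
              C⁻¹ * Matrix.det (Matrix.of fun i j : Fin d =>
                frobeniusInner
                  ((ρ (p u) : Matrix (Fin D) (Fin D) ℝ)⁻¹ *
                    matrixPartialDeriv
                      (fun w => (ρ (p w) : Matrix (Fin D) (Fin D) ℝ)) u j)
                  (matrixDeriv (fun h : G => (ρ h : Matrix (Fin D) (Fin D) ℝ)) (1 : G)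
                    (ξ i))))) := by
  have : IsTopologicalGroup G := topologicalGroup_of_lieGroup I ∞
  have hd : Module.finrank ℝ E = d := (Module.finrank_eq_card_basis ξ).trans (by simp)
  have hω := maurerCartanVolume_isLeftInvariant ξ
  have hω0 := maurerCartanVolume_ne_zero ξ
  obtain ⟨hpos, hfin⟩ := hω.measure_univ_pos_lt_top hω0 hd
  set C : ℝ := (FormField.measure (maurerCartanVolume ξ) Set.univ).toReal
  have hC0 : 0 < C := ENNReal.toReal_pos hpos.ne' hfin.ne
  have hCmass : FormField.measure (maurerCartanVolume ξ) Set.univ = ENNReal.ofReal C :=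
    (ENNReal.ofReal_toReal hfin.ne).symm
  -- the total mass of a multiple of `θ¹ ∧ ⋯ ∧ θ^d`
  have hmass : ∀ c : ℝ, c ≠ 0 →
      FormField.measure (fun g => c • maurerCartanVolume ξ g) Set.univ =
        ENNReal.ofReal (|c| * C) := by
    intro c hc
    rw [FormField.measure_smul _ hc, MeasureTheory.Measure.smul_apply, smul_eq_mul, hCmass,
      ← ENNReal.ofReal_mul (abs_nonneg c)]
  have hCinv : C⁻¹ ≠ 0 := inv_ne_zero hC0.ne'
  have hone : FormField.measure (fun g => C⁻¹ • maurerCartanVolume ξ g) Set.univ = 1 := by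
    rw [hmass _ hCinv, abs_of_pos (inv_pos.2 hC0), inv_mul_cancel₀ hC0.ne', ENNReal.ofReal_one]
  have hμ : FormField.measure (fun g => C⁻¹ • maurerCartanVolume ξ g) = μ := by
    have := (hω.smul C⁻¹).isMulLeftInvariant
    have : MeasureTheory.IsProbabilityMeasure
      (FormField.measure (fun g => C⁻¹ • maurerCartanVolume ξ g)) := ⟨hone⟩
    have hHaar : ∀ (ν : MeasureTheory.Measure G) [MeasureTheory.IsProbabilityMeasure ν]
        [ν.IsMulLeftInvariant], ν.IsHaarMeasure := fun ν _ _ =>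
      MeasureTheory.Measure.isHaarMeasure_of_isCompact_nonempty_interior ν Set.univ isCompact_univ
        (by simp) (by simp) (by simp)
    have := hHaar μ
    have := hHaar (FormField.measure (fun g => C⁻¹ • maurerCartanVolume ξ g))
    exact MeasureTheory.Measure.isHaarMeasure_eq_of_isProbabilityMeasure _ _
  have hlocal : ∀ (p : LocalParametrisation I G d) (u : EuclideanSpace ℝ (Fin d)),
      C⁻¹ * maurerCartanVolume ξ (p u) (LocalParametrisation.partialDeriv p u) =
        C⁻¹ * Matrix.det (Matrix.of fun i j : Fin d =>
          maurerCartanComponent ξ i (p u) (LocalParametrisation.partialDeriv p u j)) :=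
    fun p u => congrArg (C⁻¹ * ·) (wedgeOneForms_apply _ _)
  refine ⟨C, hC0, hCmass, ⟨fun g => smul_ne_zero hCinv (hω0 g), fun g h => ?_, hone⟩, ?_, hμ, ?_,
    ?_⟩
  · exact AlternatingMap.ext fun v => hω.smul C⁻¹ g h v
  · intro Ω hΩ
    obtain ⟨c, hc⟩ := hΩ.isLeftInvariant.exists_eq_smul ξ
    have hc0 : c ≠ 0 := by
      rintro rfl
      exact hΩ.ne_zero 1 ((hc 1).trans (zero_smul _ _))
    have hcC : |c| = C⁻¹ := by
      have h1 := hΩ.mass_one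
      rw [show Ω = fun g => c • maurerCartanVolume ξ g from funext hc, hmass c hc0,
        ENNReal.ofReal_eq_one] at h1
      exact eq_inv_of_mul_eq_one_left h1
    rcases eq_or_eq_neg_of_abs_eq hcC with h | h
    · exact Or.inl fun g => by rw [hc g, h]
    · exact Or.inr fun g => by
        rw [hc g, h]
        exact AlternatingMap.ext fun v => neg_mul C⁻¹ _
  · refine fun p => ⟨fun u _ => ?_, fun A hA hAp => ?_⟩
    · rw [← hlocal]
      exact eq_smul_coordinateVolumeForm _
    · rw [← hμ, FormField.measure_image _ p hA hAp]
      exact MeasureTheory.lintegral_congr fun u => by rw [← hlocal]; rfl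
  · refine fun D ρ _ hρ => ⟨matrixDeriv_leftMaurerCartan ρ hρ, fun horth p u hu => ?_⟩
    refine congrArg (fun M => C⁻¹ * Matrix.det (Matrix.of M)) (funext fun i => funext fun j => ?_)
    rw [matrixPartialDeriv_eq hρ p hu, ← matrixDeriv_leftMaurerCartan ρ hρ,
      frobeniusInner_matrixDeriv_eq_coord _ ξ horth]
    rfl
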